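/- **Ordered groupoids.** An *ordered groupoid* is a (small) groupoid $\mathcal G$ with a partial order on its set of arrows which is preserved by inverses and by composition ($a\le b$ and $c\le d$ imply $ac\le bd$ whenever both composites exist) and such that, with objects ordered by $A'\le A :\Leftrightarrow 1_{A'}\le 1_A$, for every $f\colon A\to B$ and $A'\le A$ there is a unique arrow $f|_{A'}\colon A'\to B'$ (for a unique $B'$) with $f|_{A'}\le f$. A *double functor* $M\colon\mathcal G\to\mathcal G'$ between ordered groupoids is a functor preserving the order on arrows. **Ehresmann sites.** A *vertical sieve* on an object $A$ is a downward closed subset of $\{A'\mid A'\le A\}$. For a vertical sieve $\mathcal B$ on $B$ and $f\colon A\to B'$ with $B'\le B$, let $f^*\mathcal B=\{A'\le A\mid \operatorname{cod}(f|_{A'})\in\mathcal B\}$. An *Ehresmann topology* $T$ on $\mathcal G$ assigns to each object $A$ a collection $T(A)$ of vertical sieves on $A$ (the covering sieves) such that: $\{A'\mid A'\le A\}\in T(A)$; if $\mathcal B\in T(B)$ and $f\colon A\to B'\le B$, then $f^*\mathcal B\in T(A)$; if $\mathcal A\in T(A)$ and $\mathcal B$ is a vertical sieve on $A$ with $f^*\mathcal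 B\in T(C)$ for every $f\colon C\to A'\le A$ with $A'\in\mathcal A$, then $\mathcal B\in T(A)$. The pair $(\mathcal G,T)$ is an *Ehresmann site*. **Sheaves.** A *presheaf* on $\mathcal G$ consists of sets $F(A)$ with maps $F(B)\to F(A)$ for each arrow $A\to B$ and for each relation $A\le B$, functorial (contravariantly) in each of the two kinds, such that for $f\le f'$ with $f\colon A\to B$, $f'\colon A'\to B'$ the square formed by $f,f'$ and $A\le A'$, $B\le B'$ commutes. Maps of presheaves are families of functions natural for both kinds of maps. $F$ is a *sheaf* on $(\mathcal G,T)$ if for every $\mathcal A\in T(A)$ every family $(x_{B})_{B\in\mathcal A}$, $x_B\in F(B)$, with $x_B|_C=x_C$ for $C\le B$, has a unique $x\in F(A)$ with $x|_B=x_B$ for all $B\in\mathcal A$. $\mathrm{Sh}(\mathcal G,T)$ is the full subcategory of sheaves. **Morphisms of Ehresmann sites.** An *hv-cone* over a double functor $D\colon\mathbb I\to\mathcal G$ from an ordered groupoid consists of an object $U$ and, for each object $i$ of $\mathbb I$, an object $E_i\le D_i$ and an arrow $\xi_i\colon U\to E_i$, such that for each $\alpha\colon i\to i'$ the restriction $D_\alpha|_{E_i}$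 has codomain $E_{i'}$ and $D_\alpha|_{E_i}\circ\xi_i=\xi_{i'}$, and for $i\le i'$ one has $\xi_i=\xi_{i'}$ (in particular $E_i=E_{i'}$). A *morphism of Ehresmann sites* $M\colon(\mathcal G,T)\to(\mathcal G',T')$ is a double functor such that: * (covering preserving) for $\mathcal A\in T(A)$, the vertical sieve on $M(A)$ generated by $\{M(A')\mid A'\in\mathcal A\}$ lies in $T'(M(A))$; * (covering flat) for each finite ordered groupoid $\mathbb I$, each double functor $D\colon\mathbb I\to\mathcal G$ and each hv-cone $(U,\xi_i\colon U\to E_i\le M(D_i))$ over $M\circ D$ there is a covering sieve in $T'(U)$ such that for each of its members $U'$ there are an hv-cone $(W,\theta_i\colon W\to A_i\le D_i)$ over $D$ and an arrow $h\colon U'\to W'$ with $W'\le M(W)$ such that $\xi_i|_{U'}=M(\theta_i)|_{W'}\circ h$ for all $i$. **Conditions.** Such an $M$ is * (ES.1) *locally full* if for all objects $A,B$ of $\mathcal G$ and every arrow $g\colon M(A)\to B'$ with $B'\le M(B)$ there are a sieve $\mathcal A\in T(A)$ and, for each $C\in\mathcal A$, an arrow $f\colon C\to D$ of $\mathcal G$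 with $D\le B$ and $g|_{M(C)}=M(f)$; * (ES.2) *locally faithful* if for arrows $f\colon A\to B_f$, $g\colon A\to B_g$ of $\mathcal G$ with $B_f\le B$, $B_g\le B$ and $M(f)=M(g)$ there is $\mathcal A\in T(A)$ with $f|_C=g|_C$ for all $C\in\mathcal A$; * (ES.3) *locally surjective on objects* if for each object $A'$ of $\mathcal G'$ there is a family of arrows $f_i\colon M(A_i)\to A_i'$ with $A'_i\le A'$ such that the vertical sieve generated by the $A'_i$ lies in $T'(A')$; * (ES.4) *co-continuous* if for each object $A$ of $\mathcal G$ and each $\mathcal A'\in T'(M(A))$ the vertical sieve $\{B\le A\mid M(B)\le C\text{ for some }C\in\mathcal A'\}$ lies in $T(A)$. **Theorem (Comparison Lemma for Ehresmann sites).** Let $M\colon(\mathcal G,T)\to(\mathcal G',T')$ be a morphism of Ehresmann sites satisfying (ES.1)–(ES.3). Then the functor $M^*\colon\mathrm{Sh}(\mathcal G',T')\to\mathrm{Sh}(\mathcal G,T)$ given by composition with $M$ is full and faithful. If $M$ moreover satisfies (ES.4), then $M^*$ is an equivalence of categories. -/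

import Mathlib

open CategoryTheory

namespace EhresmannSites

universe u v w u₁ v₁ u₂ v₂ u₃ v₃

/-! ### Ordered groupoids -/

/-- An arrow of `G`, bundled with its domain and codomain.  Equality in `Arr G` is equality
of arrows (including their domains and codomains). -/
structure Arr (G : Type u) [Quiver.{v} G] : Type (max u v) where
  /-- domain -/
  src : G
  /-- codomain -/
  tgt : G
  /-- the arrow itself -/
  hom : src ⟶ tgt

/-- A (horizontal) arrow, regarded as an element of the set of all arrows. -/
abbrev arr {G : Type u} [Quiver.{v} G] {A B : G} (f : A ⟶ B) : Arr G := ⟨A, B, f⟩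

/-- An ordered groupoid: a groupoid with a partial order on its set of arrows that is preserved
by inverses and composition, and such that every `f : A ⟶ B` has, for each `A' ≤ A`, a unique
restriction `f' : A' ⟶ B'` with `f' ≤ f`.  Objects are ordered through their identity arrows. -/
class OrderedGroupoid (G : Type u) [Groupoid.{v} G] extends PartialOrder (Arr G) where
  inv_le_inv : ∀ {A B C D : G} {f : A ⟶ B} {g : C ⟶ D},
    arr f ≤ arr g → arr (Groupoid.inv f) ≤ arr (Groupoid.inv g)
  comp_le_comp : ∀ {A B C A' B' C' : G} {f : A ⟶ B} {g : B ⟶ C} {f' : A' ⟶ B'} {g' : B' ⟶ C'},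
    arr f ≤ arr f' → arr g ≤ arr g' → arr (f ≫ g) ≤ arr (f' ≫ g')
  existsUnique_restrict : ∀ {A B A' : G} (f : A ⟶ B), arr (𝟙 A') ≤ arr (𝟙 A) →
    ∃! p : Σ B' : G, A' ⟶ B', arr p.2 ≤ arr f

/-- The order on objects of an ordered groupoid; `A ≤ᵥ B` says that there is a (necessarily unique)
vertical arrow from `A` to `B`. -/
def VLE {G : Type u} [Groupoid.{v} G] [OrderedGroupoid G] (A B : G) : Prop :=
  arr (𝟙 A) ≤ arr (𝟙 B)

infix:50 " ≤ᵥ " => VLE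

section Basic

variable {G : Type u} [Groupoid.{v} G] [OrderedGroupoid G]

theorem VLE.refl (A : G) : A ≤ᵥ A := le_refl (arr (𝟙 A))

theorem VLE.trans {A B C : G} (h : A ≤ᵥ B) (h' : B ≤ᵥ C) : A ≤ᵥ C := le_trans (α := Arr G) h h'

theorem VLE.antisymm {A B : G} (h : A ≤ᵥ B) (h' : B ≤ᵥ A) : A = B :=
  congrArg Arr.src (le_antisymm (α := Arr G) h h')

theorem src_le {A B C D : G} {f : A ⟶ B} {g : C ⟶ D} (h : arr f ≤ arr g) : A ≤ᵥ C := by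
  have := OrderedGroupoid.comp_le_comp h (OrderedGroupoid.inv_le_inv h)
  simpa [VLE] using this

theorem tgt_le {A B C D : G} {f : A ⟶ B} {g : C ⟶ D} (h : arr f ≤ arr g) : B ≤ᵥ D := by
  have := OrderedGroupoid.comp_le_comp (OrderedGroupoid.inv_le_inv h) h
  simpa [VLE] using this

theorem exists_restrict {A B A' : G} (f : A ⟶ B) (h : A' ≤ᵥ A) :
    ∃ (B' : G) (f' : A' ⟶ B'), arr f' ≤ arr f := by
  obtain ⟨p, hp, -⟩ := OrderedGroupoid.existsUnique_restrict f h
  exact ⟨p.1, p.2, hp⟩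

theorem restrict_unique {A B A' B₁ B₂ : G} {f : A ⟶ B} {f₁ : A' ⟶ B₁} {f₂ : A' ⟶ B₂}
    (h₁ : arr f₁ ≤ arr f) (h₂ : arr f₂ ≤ arr f) : arr f₁ = arr f₂ := by
  have := (OrderedGroupoid.existsUnique_restrict f (src_le h₁)).unique
    (y₁ := ⟨B₁, f₁⟩) (y₂ := ⟨B₂, f₂⟩) h₁ h₂
  cases this
  rfl

end Basic

/-! ### Double functors -/

/-- A double functor (ordered functor) between ordered groupoids: a functor that preserves the
order on arrows. -/
structure OrderedFunctor (G : Type u₁) [Groupoid.{v₁} G] [OrderedGroupoid G]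
    (G' : Type u₂) [Groupoid.{v₂} G'] [OrderedGroupoid G'] extends G ⥤ G' where
  map_le_map : ∀ {A B C D : G} {f : A ⟶ B} {g : C ⟶ D},
    arr f ≤ arr g → arr (toFunctor.map f) ≤ arr (toFunctor.map g)

namespace OrderedFunctor

variable {G : Type u₁} [Groupoid.{v₁} G] [OrderedGroupoid G]
  {G' : Type u₂} [Groupoid.{v₂} G'] [OrderedGroupoid G']
  {G'' : Type u₃} [Groupoid.{v₃} G''] [OrderedGroupoid G'']

theorem obj_le_obj (M : OrderedFunctor G G') {A B : G} (h : A ≤ᵥ B) : M.obj A ≤ᵥ M.obj B := by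
  simpa [VLE] using M.map_le_map h

/-- Composition: first `D`, then `M`. -/
def comp (D : OrderedFunctor G G') (M : OrderedFunctor G' G'') : OrderedFunctor G G'' where
  toFunctor := D.toFunctor ⋙ M.toFunctor
  map_le_map h := M.map_le_map (D.map_le_map h)

end OrderedFunctor

/-! ### Vertical sieves and Ehresmann topologies -/

/-- A vertical sieve on `A`: an order ideal (downward closed subset) of `{B | B ≤ A}`. -/
@[ext]
structure VerticalSieve {G : Type u} [Groupoid.{v} G] [OrderedGroupoid G] (A : G) where
  /-- the underlying set of objects -/
  carrier : Set G
  le : ∀ {B : G}, B ∈ carrier → B ≤ᵥ A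
  down : ∀ {B C : G}, C ≤ᵥ B → B ∈ carrier → C ∈ carrier

namespace VerticalSieve

variable {G : Type u} [Groupoid.{v} G] [OrderedGroupoid G]

instance (A : G) : Membership G (VerticalSieve A) := ⟨fun S B => B ∈ S.carrier⟩

/-- The trivial sieve `↓A`. -/
def top (A : G) : VerticalSieve A where
  carrier := {B | B ≤ᵥ A}
  le h := h
  down h h' := h.trans h'

/-- For a sieve `S` on `B`, and `f : A ⟶ B'` with `B' ≤ B`, the sieve `f^* S` on `A` consists of
those `A' ≤ A` such that the codomain of the restriction of `f` to `A'` lies in `S`. -/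
def pullback {A B' B : G} (f : A ⟶ B') (_hB : B' ≤ᵥ B) (S : VerticalSieve B) :
    VerticalSieve A where
  carrier := {A' | ∃ (B'' : G) (f' : A' ⟶ B''), arr f' ≤ arr f ∧ B'' ∈ S}
  le := by
    rintro A' ⟨B'', f', hf, -⟩
    exact src_le hf
  down := by
    rintro A' C hC ⟨B'', f', hf, hS⟩
    obtain ⟨D, g, hg⟩ := exists_restrict f' hC
    exact ⟨D, g, le_trans hg hf, S.down (tgt_le hg) hS⟩

/-- The vertical sieve generated by the image of a vertical sieve under a double functor. -/
def image {G' : Type u₂} [Groupoid.{v₂} G'] [OrderedGroupoid G'] (M : OrderedFunctor G G')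
    {A : G} (S : VerticalSieve A) : VerticalSieve (M.obj A) where
  carrier := {V | ∃ B ∈ S, V ≤ᵥ M.obj B}
  le := by
    rintro V ⟨B, hB, hV⟩
    exact hV.trans (M.obj_le_obj (S.le hB))
  down := by
    rintro V W hW ⟨B, hB, hV⟩
    exact ⟨B, hB, hW.trans hV⟩

/-- For a sieve `S` on `M A`, the sieve of all `B ≤ A` such that `M B ≤ C` for some `C ∈ S`. -/
def preimage {G' : Type u₂} [Groupoid.{v₂} G'] [OrderedGroupoid G'] (M : OrderedFunctor G G')
    {A : G} (S : VerticalSieve (M.obj A)) : VerticalSieve A where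
  carrier := {B | B ≤ᵥ A ∧ ∃ C ∈ S, M.obj B ≤ᵥ C}
  le h := h.1
  down := by
    rintro B B' hB ⟨hA, C, hC, hBC⟩
    exact ⟨hB.trans hA, C, hC, (M.obj_le_obj hB).trans hBC⟩

end VerticalSieve

/-- An Ehresmann topology on an ordered groupoid `G`; the pair `(G, T)` is an Ehresmann site. -/
structure EhresmannTopology (G : Type u) [Groupoid.{v} G] [OrderedGroupoid G] where
  /-- the covering vertical sieves on an object -/
  covers : ∀ A : G, Set (VerticalSieve A)
  top_mem : ∀ A : G, VerticalSieve.top A ∈ covers A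
  pullback_mem : ∀ {A B' B : G} (f : A ⟶ B') (hB : B' ≤ᵥ B) (S : VerticalSieve B),
    S ∈ covers B → S.pullback f hB ∈ covers A
  transitive : ∀ {A : G} (S : VerticalSieve A), S ∈ covers A → ∀ R : VerticalSieve A,
    (∀ {C A' : G} (f : C ⟶ A') (hA : A' ≤ᵥ A), A' ∈ S → R.pullback f hA ∈ covers C) →
      R ∈ covers A

/-! ### Morphisms of Ehresmann sites -/

/-- An hv-cone over a diagram `D : I → G`. -/
structure HVCone {I : Type u₁} [Groupoid.{v₁} I] [OrderedGroupoid I]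
    {G : Type u₂} [Groupoid.{v₂} G] [OrderedGroupoid G] (D : OrderedFunctor I G) where
  /-- the vertex `U` -/
  vertex : G
  /-- the objects `E i ≤ D i` -/
  pt : I → G
  pt_le : ∀ i, pt i ≤ᵥ D.obj i
  /-- the horizontal arrows `U ⟶ E i` -/
  leg : ∀ i, vertex ⟶ pt i
  /-- the restriction of `D α` to `E i` has codomain `E j`, and the triangle commutes -/
  horizontal : ∀ {i j : I} (α : i ⟶ j),
    ∃ e : pt i ⟶ pt j, arr e ≤ arr (D.map α) ∧ leg i ≫ e = leg j
  vertical : ∀ {i j : I}, i ≤ᵥ j → arr (leg i) = arr (leg j)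

section Morphisms

variable {G : Type u₁} [Groupoid.{v₁} G] [OrderedGroupoid G]
  {G' : Type u₂} [Groupoid.{v₂} G'] [OrderedGroupoid G']

/-- Covering preserving: the image of a covering sieve generates a covering sieve. -/
def CoveringPreserving (T : EhresmannTopology G) (T' : EhresmannTopology G')
    (M : OrderedFunctor G G') : Prop :=
  ∀ (A : G) (S : VerticalSieve A), S ∈ T.covers A → S.image M ∈ T'.covers (M.obj A)

/-- Covering flat: every hv-cone over `M ∘ D`, with `D` a finite diagram in `G`, factors locally
through the image of an hv-cone over `D`. -/
def CoveringFlat (T' : EhresmannTopology G') (M : OrderedFunctor G G') : Prop :=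
  ∀ (I : Type) [Groupoid.{0} I] [OrderedGroupoid I] [Finite (Arr I)]
    (D : OrderedFunctor I G) (c : HVCone (D.comp M)),
    ∃ S ∈ T'.covers c.vertex, ∀ V ∈ S,
      ∃ (d : HVCone D) (V' : G') (h : V ⟶ V'), V' ≤ᵥ M.obj d.vertex ∧
        ∀ i : I, ∃ (E : G') (e : V' ⟶ E),
          arr e ≤ arr (M.map (d.leg i)) ∧ arr (h ≫ e) ≤ arr (c.leg i)

/-- `M` is a morphism of Ehresmann sites `(G, T) → (G', T')`. -/
structure IsSiteMorphism (T : EhresmannTopology G) (T' : EhresmannTopology G')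
    (M : OrderedFunctor G G') : Prop where
  coveringPreserving : CoveringPreserving T T' M
  coveringFlat : CoveringFlat T' M

/-- Locally full: every `g : M A ⟶ B' ≤ M B` is, on a cover of `A`, given by restrictions
`g|_{M C} = M f` with `f : C ⟶ D` and `D ≤ B`. -/
def LocallyFull (T : EhresmannTopology G) (M : OrderedFunctor G G') : Prop :=
  ∀ (A B : G) (B' : G') (g : M.obj A ⟶ B'), B' ≤ᵥ M.obj B →
    ∃ S ∈ T.covers A, ∀ C ∈ S, ∃ (D : G) (f : C ⟶ D), D ≤ᵥ B ∧ arr (M.map f) ≤ arr g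

/-- Locally faithful: if `f : A ⟶ B₁ ≤ B` and `g : A ⟶ B₂ ≤ B` satisfy `M f = M g`, then `f` and
`g` have the same restrictions on a cover of `A`. -/
def LocallyFaithful (T : EhresmannTopology G) (M : OrderedFunctor G G') : Prop :=
  ∀ (A B B₁ B₂ : G) (f : A ⟶ B₁) (g : A ⟶ B₂), B₁ ≤ᵥ B → B₂ ≤ᵥ B →
    arr (M.map f) = arr (M.map g) →
      ∃ S ∈ T.covers A, ∀ C ∈ S, ∃ (D : G) (k : C ⟶ D), arr k ≤ arr f ∧ arr k ≤ arr g

/-- Locally surjective on objects: every `A'` has a covering sieve generated by objects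
`C ≤ A'` that admit a horizontal arrow `M A ⟶ C`. -/
def LocallySurjective (T' : EhresmannTopology G') (M : OrderedFunctor G G') : Prop :=
  ∀ A' : G', ∃ S ∈ T'.covers A', ∀ B ∈ S, ∃ C ∈ S, B ≤ᵥ C ∧ ∃ A : G, Nonempty (M.obj A ⟶ C)

/-- Co-continuous: for a covering sieve `S` on `M A`, those `B ≤ A` such that `M B` lies below a
member of `S` form a covering sieve of `A`. -/
def CoContinuous (T : EhresmannTopology G) (T' : EhresmannTopology G')
    (M : OrderedFunctor G G') : Prop :=
  ∀ (A : G) (S : VerticalSieve (M.obj A)), S ∈ T'.covers (M.obj A) → S.preimage M ∈ T.covers A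

end Morphisms

/-! ### Presheaves and sheaves -/

/-- A presheaf on an ordered groupoid: a double functor into quartets of sets, contravariant for
horizontal and for vertical arrows, sending double cells to commutative squares. -/
structure OGPresheaf (G : Type u) [Groupoid.{v} G] [OrderedGroupoid G] where
  /-- the set of sections on an object -/
  obj : G → Type w
  /-- action of horizontal arrows -/
  hmap : ∀ {A B : G}, (A ⟶ B) → obj B → obj A
  /-- action of vertical arrows -/
  vmap : ∀ {A B : G}, A ≤ᵥ B → obj B → obj A
  hmap_id : ∀ {A : G} (x : obj A), hmap (𝟙 A) x = x
  hmap_comp : ∀ {A B C : G} (f : A ⟶ B) (g : B ⟶ C) (x : obj C),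
    hmap (f ≫ g) x = hmap f (hmap g x)
  vmap_refl : ∀ {A : G} (h : A ≤ᵥ A) (x : obj A), vmap h x = x
  vmap_trans : ∀ {A B C : G} (h : A ≤ᵥ B) (h' : B ≤ᵥ C) (h'' : A ≤ᵥ C) (x : obj C),
    vmap h'' x = vmap h (vmap h' x)
  square : ∀ {A B A' B' : G} (f : A ⟶ B) (f' : A' ⟶ B') (_ : arr f ≤ arr f')
    (hA : A ≤ᵥ A') (hB : B ≤ᵥ B') (x : obj B'),
    vmap hA (hmap f' x) = hmap f (vmap hB x)

namespace OGPresheaf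

variable {G : Type u} [Groupoid.{v} G] [OrderedGroupoid G]

/-- A map of presheaves: a family of functions, natural for horizontal and vertical arrows. -/
@[ext]
structure Hom (P Q : OGPresheaf.{u, v, w} G) where
  /-- the components -/
  app : ∀ A : G, P.obj A → Q.obj A
  hnat : ∀ {A B : G} (f : A ⟶ B) (x : P.obj B), app A (P.hmap f x) = Q.hmap f (app B x)
  vnat : ∀ {A B : G} (h : A ≤ᵥ B) (x : P.obj B), app A (P.vmap h x) = Q.vmap h (app B x)

instance : Category (OGPresheaf.{u, v, w} G) where
  Hom P Q := Hom P Q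
  id P := { app := fun _ x => x, hnat := fun _ _ => rfl, vnat := fun _ _ => rfl }
  comp α β :=
    { app := fun A x => β.app A (α.app A x)
      hnat := fun f x => by rw [α.hnat, β.hnat]
      vnat := fun h x => by rw [α.vnat, β.vnat] }

/-- A presheaf is a sheaf if, for every covering vertical sieve, every matching family has a
unique amalgamation. -/
def IsSheaf (T : EhresmannTopology G) : ObjectProperty (OGPresheaf.{u, v, w} G) := fun P =>
  ∀ (A : G) (S : VerticalSieve A), S ∈ T.covers A →
    ∀ x : (∀ B : G, B ∈ S → P.obj B),
      (∀ (B C : G) (hB : B ∈ S) (hC : C ∈ S) (h : C ≤ᵥ B), P.vmap h (x B hB) = x C hC) →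
        ∃! a : P.obj A, ∀ (B : G) (hB : B ∈ S), P.vmap (S.le hB) a = x B hB

end OGPresheaf

/-- The category of sheaves on an Ehresmann site. -/
abbrev Sh {G : Type u} [Groupoid.{v} G] [OrderedGroupoid G] (T : EhresmannTopology G) :=
  (OGPresheaf.IsSheaf.{u, v, w} T).FullSubcategory

section Restriction

variable {G : Type u₁} [Groupoid.{v₁} G] [OrderedGroupoid G]
  {G' : Type u₂} [Groupoid.{v₂} G'] [OrderedGroupoid G']

/-- Restriction of presheaves along a double functor, i.e. composition with `M`. -/
def presheafRestriction (M : OrderedFunctor G G') :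
    OGPresheaf.{u₂, v₂, w} G' ⥤ OGPresheaf.{u₁, v₁, w} G where
  obj P :=
    { obj := fun A => P.obj (M.obj A)
      hmap := fun f => P.hmap (M.map f)
      vmap := fun h => P.vmap (M.obj_le_obj h)
      hmap_id := fun x => by rw [M.map_id, P.hmap_id]
      hmap_comp := fun f g x => by rw [M.map_comp, P.hmap_comp]
      vmap_refl := fun h x => P.vmap_refl _ x
      vmap_trans := fun h h' h'' x => P.vmap_trans _ _ _ x
      square := fun f f' hf hA hB x => P.square _ _ (M.map_le_map hf) _ _ x }
  map α :=
    { app := fun A => α.app (M.obj A)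
      hnat := fun f x => α.hnat (M.map f) x
      vnat := fun h x => α.vnat (M.obj_le_obj h) x }

/-! #### Restriction along a morphism of sites preserves sheaves -/

/-- The shape `left ≤ top ≥ right`, with identities as only horizontal arrows. -/
inductive Cosp : Type
  | left | right | top

instance : Groupoid.{0} Cosp where
  Hom i j := PLift (i = j)
  id i := ⟨rfl⟩
  comp f g := ⟨f.down.trans g.down⟩
  inv f := ⟨f.down.symm⟩

theorem Cosp.arr_ext {a b : Arr Cosp} (h : a.src = b.src) : a = b := by
  obtain ⟨i, j, ⟨rfl⟩⟩ := a
  obtain ⟨k, l, ⟨rfl⟩⟩ := b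
  cases h
  rfl

instance : Finite (Arr Cosp) := by
  have : Finite Cosp := Finite.of_injective
    (fun i : Cosp => match i with | .left => (0 : Fin 3) | .right => 1 | .top => 2) (by
      intro i j h
      cases i <;> cases j <;> simp_all)
  exact Finite.of_injective Arr.src fun _ _ h => Cosp.arr_ext h

instance : OrderedGroupoid Cosp where
  le a b := a.src = b.src ∨ b.src = .top
  le_refl a := Or.inl rfl
  le_trans a b c h h' := by
    rcases h with h | h <;> rcases h' with h' | h'
    · exact Or.inl (h.trans h')
    · exact Or.inr h'
    · exact Or.inr (h'.symm.trans h)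
    · exact Or.inr h'
  le_antisymm a b h h' := by
    apply Cosp.arr_ext
    rcases h with h | h
    · exact h
    · rcases h' with h' | h'
      · exact h'.symm
      · exact h'.trans h.symm
  inv_le_inv := by
    rintro A B C D ⟨rfl⟩ ⟨rfl⟩ h
    exact h
  comp_le_comp h _ := h
  existsUnique_restrict := by
    rintro A B A' f h
    refine ⟨⟨A', 𝟙 A'⟩, h, ?_⟩
    rintro ⟨B', ⟨rfl⟩⟩ -
    rfl

theorem Cosp.eq_or_eq_top {i j : Cosp} (h : i ≤ᵥ j) : i = j ∨ j = .top := h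

/-- The diagram `B ≤ A ≥ C`. -/
def cospDiagram {A B C : G} (hB : B ≤ᵥ A) (hC : C ≤ᵥ A) : OrderedFunctor Cosp G where
  obj i := match i with | .left => B | .right => C | .top => A
  map {i j} f := eqToHom (by rw [f.down])
  map_id _ := rfl
  map_comp _ _ := by simp
  map_le_map := by
    rintro i _ k _ ⟨rfl⟩ ⟨rfl⟩ h
    rcases h with h | h
    · cases h
      exact le_rfl
    · cases h
      cases i
      · exact hB
      · exact hC
      · exact VLE.refl A

/-- The hv-cone `V = V ≤ M B, M C, M A`. -/
def cospCone (M : OrderedFunctor G G') {A B C : G} (hB : B ≤ᵥ A) (hC : C ≤ᵥ A) {V : G'}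
    (hVB : V ≤ᵥ M.obj B) (hVC : V ≤ᵥ M.obj C) : HVCone ((cospDiagram hB hC).comp M) where
  vertex := V
  pt _ := V
  pt_le i := match i with
    | .left => hVB
    | .right => hVC
    | .top => hVB.trans (M.obj_le_obj hB)
  leg _ := 𝟙 V
  horizontal := by
    rintro i _ ⟨rfl⟩
    refine ⟨𝟙 V, ?_, by simp⟩
    have : ((cospDiagram hB hC).comp M).map (𝟙 i) = 𝟙 _ :=
      ((cospDiagram hB hC).comp M).map_id i
    change _ ≤ arr (((cospDiagram hB hC).comp M).map (𝟙 i))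
    rw [this]
    cases i
    · exact hVB
    · exact hVC
    · exact hVB.trans (M.obj_le_obj hB)
  vertical _ := rfl

theorem isSheaf_restriction {T : EhresmannTopology G} {T' : EhresmannTopology G'}
    {M : OrderedFunctor G G'} (hM : IsSiteMorphism T T' M) (P : OGPresheaf.{u₂, v₂, w} G')
    (hP : P.IsSheaf T') : ((presheafRestriction M).obj P).IsSheaf T := by
  intro A S hS (x : ∀ B : G, B ∈ S → P.obj (M.obj B)) (hx' : ∀ (B C : G) (hB : B ∈ S)
    (hC : C ∈ S) (h : C ≤ᵥ B), P.vmap (M.obj_le_obj h) (x B hB) = x C hC)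
  change ∃! a : P.obj (M.obj A), ∀ (B : G) (hB : B ∈ S),
    P.vmap (M.obj_le_obj (S.le hB)) a = x B hB
  have compat : ∀ (V : G') (B C : G) (hB : B ∈ S) (hC : C ∈ S) (hVB : V ≤ᵥ M.obj B)
      (hVC : V ≤ᵥ M.obj C), P.vmap hVB (x B hB) = P.vmap hVC (x C hC) := by
    intro V B C hB hC hVB hVC
    obtain ⟨R, hR, hR'⟩ := hM.coveringFlat Cosp (cospDiagram (S.le hB) (S.le hC))
      (cospCone M (S.le hB) (S.le hC) hVB hVC)
    change VerticalSieve V at R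
    change R ∈ T'.covers V at hR
    refine (hP V R hR (fun W hW => P.vmap (R.le hW) (P.vmap hVB (x B hB))) ?_).unique
      (fun W hW => rfl) ?_
    · intro W W' hW hW' h
      exact (P.vmap_trans _ _ _ _).symm
    · intro W hW
      obtain ⟨d, V', h, hV', hd⟩ := hR' W hW
      have e1 : d.pt .left = d.pt .top := congrArg Arr.tgt (d.vertical (Or.inr rfl))
      have e2 : d.pt .right = d.pt .top := congrArg Arr.tgt (d.vertical (Or.inr rfl))
      have hDB : d.pt .top ≤ᵥ B := e1 ▸ d.pt_le .left
      have hDC : d.pt .top ≤ᵥ C := e2 ▸ d.pt_le .right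
      obtain ⟨E, e, he, he'⟩ := hd .top
      have hWid : arr (𝟙 W) ≤ arr (𝟙 V) := R.le hW
      have := restrict_unique he' hWid
      have hEW : E = W := congrArg Arr.tgt this
      have hWD : W ≤ᵥ M.obj (d.pt .top) := hEW ▸ tgt_le he
      have hD : d.pt .top ∈ S := S.down hDB hB
      rw [← P.vmap_trans (R.le hW) hVC (hWD.trans (M.obj_le_obj hDC)),
        ← P.vmap_trans (R.le hW) hVB (hWD.trans (M.obj_le_obj hDB)),
        P.vmap_trans hWD (M.obj_le_obj hDC), P.vmap_trans hWD (M.obj_le_obj hDB),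
        hx' C _ hC hD hDC, hx' B _ hB hD hDB]
  choose B hB hVB using fun (V : G') (hV : V ∈ S.image M) => hV
  obtain ⟨a, ha, hau⟩ := hP (M.obj A) (S.image M) (hM.coveringPreserving A S hS)
    (fun V hV => P.vmap (hVB V hV) (x _ (hB V hV))) (by
      intro V W hV hW h
      rw [← P.vmap_trans h (hVB V hV) (h.trans (hVB V hV))]
      exact compat _ _ _ _ _ _ _)
  refine ⟨a, ?_, ?_⟩
  · intro C hC
    have hV : M.obj C ∈ S.image M := ⟨C, hC, VLE.refl _⟩
    refine (ha (M.obj C) hV).trans ?_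
    rw [compat _ _ C (hB _ hV) hC (hVB _ hV) (VLE.refl _), P.vmap_refl]
  · intro b hb
    apply hau
    intro V hV
    have hb' : P.vmap (M.obj_le_obj (S.le (hB V hV))) b = x _ (hB V hV) := hb _ (hB V hV)
    change _ = P.vmap (hVB V hV) (x _ (hB V hV))
    rw [← hb']
    exact P.vmap_trans _ _ _ _

/-- Restriction of sheaves along a morphism of Ehresmann sites,
`M^* : Sh(G', T') ⥤ Sh(G, T)`, given by composition with `M`. -/
def sheafRestriction {T : EhresmannTopology G} {T' : EhresmannTopology G'}
    {M : OrderedFunctor G G'} (hM : IsSiteMorphism T T' M) :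
    Sh.{u₂, v₂, w} T' ⥤ Sh.{u₁, v₁, w} T :=
  (OGPresheaf.IsSheaf T).lift ((OGPresheaf.IsSheaf T').ι ⋙ presheafRestriction M)
    fun P => isSheaf_restriction hM P.obj P.property

end Restriction

end EhresmannSites

open EhresmannSites

universe u

open CategoryTheory Opposite

namespace EhresmannSites

/-! ### The category associated with an ordered groupoid -/

/-! The theorem is reduced to the comparison lemma for Grothendieck sites. An ordered groupoid has
an associated ordinary category, in which every morphism factors as a horizontal arrow followed by a
vertical one. Horizontal arrows are invertible, so a sieve there is determined by the vertical
arrows it contains (`sieve_iff`). Sieves are therefore the same as vertical sieves, an Ehresmann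
topology becomes a Grothendieck topology (`topology`), and the two notions of sheaf agree
(`isSheaf_iff`), which makes `sheafFunctor` an equivalence.

A double functor `M` induces a functor of associated categories, and the conditions on `M`
translate: local surjectivity gives cover-density, local fullness and faithfulness give their
sitewise analogues, and co-continuity adds that a sieve is covering as soon as its image is
(`mem_of_functorPushforward_mem`), i.e. a dense subsite. The known results for ordinary sites are
then carried back along `sheafRestrictionIso`. -/

/-- The category associated with an ordered groupoid `G`: it has the objects of `G`, and a morphism
`A ⟶ B` is a horizontal arrow `A ⟶ B'` followed by a vertical arrow `B' ≤ B`. -/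
structure AssociatedCategory (G : Type u) where
  /-- the associated category, on objects -/
  of ::
  /-- the underlying object -/
  as : G

namespace AssociatedCategory

section Category

variable {G : Type u} [Groupoid.{v} G] [OrderedGroupoid G]

/-- A morphism of the associated category: a horizontal arrow followed by a vertical one. -/
structure Hom (A B : AssociatedCategory G) : Type (max u v) where
  /-- the codomain of the horizontal part -/
  mid : G
  /-- the horizontal part -/
  hom : A.as ⟶ mid
  mid_le : mid ≤ᵥ B.as

theorem Hom.ext_arr {A B : AssociatedCategory G} {f g : Hom A B} (h : arr f.hom = arr g.hom) :
    f = g := by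
  obtain ⟨m, f, hf⟩ := f
  obtain ⟨n, g, hg⟩ := g
  cases h
  rfl

/-- Composition restricts the second horizontal arrow. -/
noncomputable def Hom.comp {A B C : AssociatedCategory G} (f : Hom A B) (g : Hom B C) :
    Hom A C where
  mid := (exists_restrict g.hom f.mid_le).choose
  hom := f.hom ≫ (exists_restrict g.hom f.mid_le).choose_spec.choose
  mid_le := (tgt_le (exists_restrict g.hom f.mid_le).choose_spec.choose_spec).trans g.mid_le

/-- Uniqueness of restrictions makes the choice in `Hom.comp` irrelevant: a composite can be
computed with any convenient restriction `k`. -/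
theorem Hom.comp_eq {A B C : AssociatedCategory G} (f : Hom A B) (g : Hom B C) {m : G}
    (k : f.mid ⟶ m) (hk : arr k ≤ arr g.hom) :
    f.comp g = ⟨m, f.hom ≫ k, (tgt_le hk).trans g.mid_le⟩ := by
  apply Hom.ext_arr
  have h := restrict_unique (exists_restrict g.hom f.mid_le).choose_spec.choose_spec hk
  dsimp only [Hom.comp]
  -- With the chosen arrow and its codomain replaced by variables, the equality of bundled arrows
  -- can be eliminated.
  generalize (exists_restrict g.hom f.mid_le).choose_spec.choose = l at h
  generalize (exists_restrict g.hom f.mid_le).choose = n at l h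
  cases h
  rfl

noncomputable instance : Category.{max u v} (AssociatedCategory G) where
  Hom := Hom
  id A := ⟨A.as, 𝟙 A.as, VLE.refl _⟩
  comp f g := f.comp g
  id_comp {A B} f := by
    rw [Hom.comp_eq (⟨A.as, 𝟙 A.as, VLE.refl _⟩ : Hom A A) f f.hom le_rfl]
    exact Hom.ext_arr (by simp)
  comp_id {A B} f := by
    rw [Hom.comp_eq f (⟨B.as, 𝟙 B.as, VLE.refl _⟩ : Hom B B) (𝟙 _) f.mid_le]
    exact Hom.ext_arr (by simp)
  assoc {A B C D} f g h := by
    -- Both bracketings reduce to `f.hom ≫ k ≫ q`: `q` restricts `h.hom` to the codomain of `k`, and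
    -- `k ≫ q` restricts `g.hom ≫ l`.
    obtain ⟨m, k, hk⟩ := exists_restrict g.hom f.mid_le
    obtain ⟨n, l, hl⟩ := exists_restrict h.hom g.mid_le
    obtain ⟨p, q, hq⟩ := exists_restrict l (tgt_le hk)
    rw [Hom.comp_eq f g k hk, Hom.comp_eq g h l hl, Hom.comp_eq _ h q (le_trans hq hl),
      Hom.comp_eq f _ (k ≫ q) (OrderedGroupoid.comp_le_comp hk hq)]
    exact Hom.ext_arr (by simp)

theorem hom_ext {A B : AssociatedCategory G} {f g : A ⟶ B} (h : arr f.hom = arr g.hom) :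
    f = g :=
  Hom.ext_arr h

theorem comp_eq {A B C : AssociatedCategory G} (f : A ⟶ B) (g : B ⟶ C) {m : G}
    (k : f.mid ⟶ m) (hk : arr k ≤ arr g.hom) :
    f ≫ g = (⟨m, f.hom ≫ k, (tgt_le hk).trans g.mid_le⟩ : Hom A C) :=
  Hom.comp_eq f g k hk

/-- A horizontal arrow, as a morphism of the associated category. -/
def ofHom {A B : G} (f : A ⟶ B) : of A ⟶ of B :=
  (⟨B, f, VLE.refl B⟩ : Hom (of A) (of B))

/-- A vertical arrow, as a morphism of the associated category. -/
def ofLE {A B : G} (h : A ≤ᵥ B) : of A ⟶ of B :=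
  (⟨A, 𝟙 A, h⟩ : Hom (of A) (of B))

theorem ofHom_id (A : G) : ofHom (𝟙 A) = 𝟙 (of A) := rfl

theorem ofLE_refl {A : G} (h : A ≤ᵥ A) : ofLE h = 𝟙 (of A) := rfl

theorem ofHom_comp {A B C : G} (f : A ⟶ B) (g : B ⟶ C) : ofHom (f ≫ g) = ofHom f ≫ ofHom g :=
  (comp_eq (ofHom f) (ofHom g) g le_rfl).symm

/-- Precomposition with a vertical arrow is restriction of the horizontal part; this is how
order-theoretic statements about restrictions become equations between morphisms. -/
theorem ofLE_comp_eq {A B : G} {C : AssociatedCategory G} (h : A ≤ᵥ B) (g : of B ⟶ C) {m : G}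
    (k : A ⟶ m) (hk : arr k ≤ arr g.hom) :
    ofLE h ≫ g = (⟨m, k, (tgt_le hk).trans g.mid_le⟩ : Hom (of A) C) := by
  rw [comp_eq (ofLE h) g k hk]
  exact hom_ext (congrArg arr (Category.id_comp k))

theorem ofLE_comp {A B C : G} (h : A ≤ᵥ B) (h' : B ≤ᵥ C) :
    ofLE h ≫ ofLE h' = ofLE (h.trans h') :=
  ofLE_comp_eq h (ofLE h') (𝟙 A) h

theorem ofHom_comp_ofLE {A : AssociatedCategory G} {B' B : G} (f : A.as ⟶ B') (h : B' ≤ᵥ B) :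
    ofHom f ≫ ofLE h = (⟨B', f, h⟩ : Hom A (of B)) := by
  refine (comp_eq (ofHom f) (ofLE h) (𝟙 B') le_rfl).trans ?_
  exact hom_ext (congrArg arr (Category.comp_id f))

theorem hom_fac {A B : AssociatedCategory G} (f : A ⟶ B) : ofHom f.hom ≫ ofLE f.mid_le = f :=
  ofHom_comp_ofLE f.hom f.mid_le

theorem square {A B A' B' : G} {f : A ⟶ B} {f' : A' ⟶ B'} (h : arr f ≤ arr f')
    (hA : A ≤ᵥ A') (hB : B ≤ᵥ B') : ofLE hA ≫ ofHom f' = ofHom f ≫ ofLE hB := by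
  rw [ofLE_comp_eq hA (ofHom f') f h]
  exact (ofHom_comp_ofLE (A := of A) f hB).symm

/-- The horizontal arrow of a morphism is invertible, so its vertical part belongs to every sieve
the morphism belongs to. -/
theorem inv_comp {A B : AssociatedCategory G} (f : A ⟶ B) :
    ofHom (Groupoid.inv f.hom) ≫ f = ofLE f.mid_le := by
  rw [comp_eq (ofHom (Groupoid.inv f.hom)) f f.hom le_rfl]
  exact hom_ext (congrArg arr (Groupoid.inv_comp f.hom))

theorem ofHom_inv_comp {A B : G} (f : A ⟶ B) : ofHom (Groupoid.inv f) ≫ ofHom f = 𝟙 (of B) :=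
  inv_comp (ofHom f)

/-- A morphism and its vertical part differ by an invertible horizontal arrow on the source side, so
each is a precomposite of the other. -/
theorem sieve_iff {A B : AssociatedCategory G} (S : Sieve B) (f : A ⟶ B) :
    S f ↔ S (ofLE f.mid_le) := by
  refine ⟨fun h => ?_, fun h => ?_⟩
  · rw [← inv_comp f]
    exact S.downward_closed h _
  · rw [← hom_fac f]
    exact S.downward_closed h _

/-! ### Sieves and topologies -/

/-- The vertical sieve of all vertical arrows in a sieve. -/
def vertical {A : G} (S : Sieve (of A)) : VerticalSieve A where
  carrier := {B | ∃ h : B ≤ᵥ A, S (ofLE h)}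
  le h := h.1
  down := by
    rintro B C hC ⟨h, hS⟩
    refine ⟨hC.trans h, ?_⟩
    rw [← ofLE_comp hC h]
    exact S.downward_closed hS _

theorem mem_vertical {A B : G} (S : Sieve (of A)) (h : B ≤ᵥ A) :
    B ∈ vertical S ↔ S (ofLE h) :=
  ⟨fun h' => h'.2, fun h' => ⟨h, h'⟩⟩

theorem mid_mem_vertical {A : G} {B : AssociatedCategory G} (S : Sieve (of A)) (f : B ⟶ of A) :
    f.mid ∈ vertical S ↔ S f :=
  (mem_vertical S f.mid_le).trans (sieve_iff S f).symm

/-- The sieve generated by a vertical sieve. -/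
def sieve {A : G} (S : VerticalSieve A) : Sieve (of A) where
  arrows _ f := f.mid ∈ S
  downward_closed := by
    intro B C f hf g
    obtain ⟨m, k, hk⟩ := exists_restrict f.hom g.mid_le
    rw [comp_eq g f k hk]
    exact S.down (tgt_le hk) hf

theorem vertical_sieve {A : G} (S : VerticalSieve A) : vertical (sieve S) = S := by
  ext B
  exact ⟨fun h => h.2, fun h => ⟨S.le h, h⟩⟩

theorem vertical_top (A : G) : vertical (⊤ : Sieve (of A)) = VerticalSieve.top A := by
  ext B
  exact ⟨fun h => h.1, fun h => ⟨h, trivial⟩⟩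

/-- For vertical arrows into `A`, composing with `f` restricts its horizontal part, so membership in
the pullback is decided by the codomain of that restriction. This matches the two pullbacks used in
the topology axioms. -/
theorem vertical_pullback {A B : G} (S : Sieve (of B)) (f : of A ⟶ of B) :
    vertical (S.pullback f) = (vertical S).pullback f.hom f.mid_le := by
  ext C
  constructor
  · rintro ⟨h, hS⟩
    obtain ⟨m, k, hk⟩ := exists_restrict f.hom h
    change S _ at hS
    rw [ofLE_comp_eq h f k hk] at hS
    exact ⟨m, k, hk, (mid_mem_vertical S _).2 hS⟩
  · rintro ⟨m, k, hk, hm⟩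
    refine ⟨src_le hk, ?_⟩
    change S _
    rw [ofLE_comp_eq _ f k hk]
    exact (mid_mem_vertical S _).1 hm

/-- The Grothendieck topology on the associated category given by an Ehresmann topology. -/
noncomputable def topology (T : EhresmannTopology G) :
    GrothendieckTopology (AssociatedCategory G) where
  sieves A := {S : Sieve (of A.as) | vertical S ∈ T.covers A.as}
  top_mem' A := by
    change vertical (⊤ : Sieve (of A.as)) ∈ T.covers A.as
    rw [vertical_top]
    exact T.top_mem _
  pullback_stable' A B S f hS := by
    change vertical (A := B.as) (Sieve.pullback f S) ∈ T.covers B.as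
    rw [vertical_pullback (A := B.as) (B := A.as)]
    exact T.pullback_mem _ _ _ hS
  transitive' A S hS R h := by
    -- The pairs `f : C ⟶ A'`, `A' ≤ A` tested by Ehresmann transitivity are exactly the morphisms
    -- `C ⟶ A` of the associated category.
    refine T.transitive _ hS _ fun {C A'} f hA hA' => ?_
    have hf : S (⟨A', f, hA⟩ : Hom (of C) A) :=
      (mid_mem_vertical (A := A.as) S (⟨A', f, hA⟩ : Hom (of C) A)).1 hA'
    have := h hf
    change vertical (A := C) (Sieve.pullback _ R) ∈ T.covers C at this
    rwa [vertical_pullback (A := C) (B := A.as)] at this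

theorem mem_topology {T : EhresmannTopology G} {A : G} {S : Sieve (of A)} :
    S ∈ topology T (of A) ↔ vertical S ∈ T.covers A :=
  Iff.rfl

theorem sieve_mem_topology {T : EhresmannTopology G} {A : G} {S : VerticalSieve A}
    (hS : S ∈ T.covers A) : sieve S ∈ topology T (of A) := by
  rwa [mem_topology, vertical_sieve]

/-- The working criterion for covering sieves below: only the vertical arrows coming from a covering
vertical sieve have to be checked. -/
theorem mem_topology_of_le {T : EhresmannTopology G} {A : G} {S : VerticalSieve A}
    (hS : S ∈ T.covers A) {R : Sieve (of A)} (h : ∀ B (hB : B ∈ S), R (ofLE (S.le hB))) :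
    R ∈ topology T (of A) := by
  refine (topology T).superset_covering ?_ (sieve_mem_topology hS)
  intro B f hf
  exact (sieve_iff R f).2 (h _ hf)

/-! ### Presheaves -/

/-- A presheaf on an ordered groupoid, as a presheaf on the associated category. -/
noncomputable def presheafFunctor :
    OGPresheaf.{u, v, w} G ⥤ (AssociatedCategory G)ᵒᵖ ⥤ Type w where
  obj P :=
    { obj := fun A => P.obj A.unop.as
      map := fun {A B} f => TypeCat.ofHom fun x => P.hmap f.unop.hom (P.vmap f.unop.mid_le x)
      map_id := by
        intro A
        ext x
        change P.hmap (𝟙 _) (P.vmap (VLE.refl _) x) = x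
        rw [P.hmap_id, P.vmap_refl]
      map_comp := by
        intro A B C f g
        ext x
        -- The double cell from `k` to `f.unop.hom` lets the vertical action be moved past the
        -- horizontal one.
        obtain ⟨m, k, hk⟩ := exists_restrict f.unop.hom g.unop.mid_le
        change P.hmap (g.unop ≫ f.unop).hom (P.vmap (g.unop ≫ f.unop).mid_le x) =
          P.hmap g.unop.hom (P.vmap g.unop.mid_le (P.hmap f.unop.hom (P.vmap f.unop.mid_le x)))
        rw [comp_eq g.unop f.unop k hk]
        dsimp only
        rw [P.square k f.unop.hom hk g.unop.mid_le (tgt_le hk), P.hmap_comp,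
          P.vmap_trans (tgt_le hk) f.unop.mid_le] }
  map α :=
    { app := fun A => TypeCat.ofHom (α.app A.unop.as)
      naturality := by
        intro A B f
        ext x
        change α.app _ (_) = _
        exact (α.hnat _ _).trans (congrArg _ (α.vnat _ _)) }

theorem presheafFunctor_map_apply (P : OGPresheaf.{u, v, w} G) {A B : AssociatedCategory G}
    (f : A ⟶ B) (x : P.obj B.as) :
    (presheafFunctor.obj P).map f.op x = P.hmap f.hom (P.vmap f.mid_le x) :=
  rfl

theorem presheafFunctor_map_ofHom (P : OGPresheaf.{u, v, w} G) {A B : G}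
    (f : A ⟶ B) (x : P.obj B) :
    (presheafFunctor.obj P).map (ofHom f).op x = P.hmap f x :=
  congrArg (P.hmap f) (P.vmap_refl _ x)

theorem presheafFunctor_map_ofLE (P : OGPresheaf.{u, v, w} G) {A B : G}
    (h : A ≤ᵥ B) (x : P.obj B) :
    (presheafFunctor.obj P).map (ofLE h).op x = P.vmap h x :=
  P.hmap_id _

instance : (presheafFunctor.{u, v, w} (G := G)).Faithful where
  map_injective {P Q α β} h := by
    apply OGPresheaf.Hom.ext
    funext A x
    exact ConcreteCategory.congr_hom (NatTrans.congr_app h (op (of A))) x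

instance : (presheafFunctor.{u, v, w} (G := G)).Full where
  map_surjective {P Q} β := by
    refine ⟨{ app := fun A x => β.app (op (of A)) x, hnat := ?_, vnat := ?_ }, rfl⟩
    · intro A B f x
      exact (congrArg (β.app (op (of A))) (presheafFunctor_map_ofHom P f x).symm).trans
        ((ConcreteCategory.congr_hom (β.naturality (ofHom f).op) x).trans
          (presheafFunctor_map_ofHom Q f _))
    · intro A B f x
      exact (congrArg (β.app (op (of A))) (presheafFunctor_map_ofLE P f x).symm).trans
        ((ConcreteCategory.congr_hom (β.naturality (ofLE f).op) x).trans
          (presheafFunctor_map_ofLE Q f _))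

/-- A presheaf on the associated category, as a presheaf on the ordered groupoid. -/
noncomputable def ogPresheaf (F : (AssociatedCategory G)ᵒᵖ ⥤ Type w) : OGPresheaf.{u, v, w} G where
  obj A := F.obj (op (of A))
  hmap f := F.map (ofHom f).op
  vmap h := F.map (ofLE h).op
  hmap_id x := by
    rw [ofHom_id, op_id, F.map_id]
    rfl
  hmap_comp f g x := by
    rw [ofHom_comp, op_comp, F.map_comp]
    rfl
  vmap_refl h x := by
    rw [ofLE_refl, op_id, F.map_id]
    rfl
  vmap_trans h h' h'' x := by
    rw [← ofLE_comp h h', op_comp, F.map_comp]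
    rfl
  square f f' h hA hB x := by
    have := congrArg (fun k => F.map k.op x) (square h hA hB)
    rw [op_comp, op_comp, F.map_comp, F.map_comp] at this
    exact this

/-- The presheaf on the associated category can be recovered. -/
noncomputable def presheafFunctorOGPresheafIso (F : (AssociatedCategory G)ᵒᵖ ⥤ Type w) :
    presheafFunctor.obj (ogPresheaf F) ≅ F :=
  NatIso.ofComponents (fun A => Iso.refl _) (by
    intro A B f
    ext x
    have e := congrArg (fun k => F.map k.op) (hom_fac f.unop)
    rw [op_comp, F.map_comp] at e
    exact ConcreteCategory.congr_hom e x)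

/-! ### Sheaves -/

/-- A matching family on a vertical sieve extends uniquely to the generated sieve by acting with the
horizontal part of each morphism; conversely, a compatible family on a sieve is determined by its
values on vertical arrows. Amalgamations correspond. -/
theorem isSheaf_iff (T : EhresmannTopology G) (P : OGPresheaf.{u, v, w} G) :
    Presieve.IsSheaf (topology T) (presheafFunctor.obj P) ↔ P.IsSheaf T := by
  constructor
  · intro h A S hS x hx
    have key := h (sieve S : Sieve (of A)) (sieve_mem_topology hS)
    let y : Presieve.FamilyOfElements (presheafFunctor.obj P) (sieve S).arrows :=
      fun B f hf => P.hmap f.hom (x f.mid hf)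
    have hy : y.Compatible := by
      rw [Presieve.compatible_iff_sieveCompatible]
      intro B C f g hf
      rw [presheafFunctor_map_apply]
      obtain ⟨m, k, hk⟩ := exists_restrict f.hom g.mid_le
      have hm : m ∈ S := S.down (tgt_le hk) hf
      have e : y (g ≫ f) ((sieve S).downward_closed hf g) = P.hmap (g.hom ≫ k) (x m hm) := by
        -- The type of `x f.mid` depends on the morphism, so the composite is first generalized to a
        -- variable `l` and then substituted.
        have : ∀ (l : C ⟶ of A) (hl : sieve S l), l = (⟨m, g.hom ≫ k, S.le hm⟩ : Hom C (of A)) →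
            y l hl = P.hmap (g.hom ≫ k) (x m hm) := by
          rintro _ _ rfl
          rfl
        exact this _ _ (comp_eq g f k hk)
      refine e.trans ?_
      rw [P.square k f.hom hk g.mid_le (tgt_le hk), P.hmap_comp, hx _ _ hf hm]
    obtain ⟨a, ha, hau⟩ := key y hy
    refine ⟨a, fun B hB => ?_, fun b hb => hau b fun B f hf => ?_⟩
    · exact (presheafFunctor_map_ofLE P (S.le hB) a).symm.trans
        ((ha (ofLE (S.le hB)) hB).trans (P.hmap_id _))
    · exact congrArg (P.hmap f.hom) (hb f.mid hf)
  · intro h A S hS y hy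
    have hA : vertical (A := A.as) S ∈ T.covers A.as := hS
    obtain ⟨a, ha, hau⟩ := h A.as (vertical S) hA (fun B hB => y (ofLE hB.1) hB.2) (by
      intro B C hB hC hCB
      have := hy (ofLE hCB) (𝟙 _) hB.2 hC.2 (by rw [ofLE_comp, Category.id_comp])
      rw [op_id, CategoryTheory.Functor.map_id] at this
      exact (presheafFunctor_map_ofLE P hCB _).symm.trans this)
    refine ⟨a, fun B f hf => ?_, fun b hb => hau b fun B hB => ?_⟩
    · have hm := (mid_mem_vertical (A := A.as) S f).2 hf
      -- Compatibility along the factorization of `f` recovers the value at `f` from the value at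
      -- its vertical part.
      have := hy (ofHom f.hom) (𝟙 _) hm.2 hf (by rw [Category.id_comp]; exact hom_fac f)
      rw [op_id, CategoryTheory.Functor.map_id] at this
      exact (congrArg (P.hmap f.hom) (ha f.mid hm)).trans
        ((presheafFunctor_map_ofHom P f.hom _).symm.trans this)
    · exact (presheafFunctor_map_ofLE P hB.1 b).symm.trans (hb _ hB.2)

/-- A sheaf on an Ehresmann site, as a sheaf on the associated category. -/
noncomputable def sheafFunctor (T : EhresmannTopology G) :
    Sh.{u, v, w} T ⥤ Sheaf (topology T) (Type w) :=
  ObjectProperty.lift _ ((OGPresheaf.IsSheaf T).ι ⋙ presheafFunctor) fun P =>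
    (isSheaf_iff_isSheaf_of_type _ _).2 ((isSheaf_iff T P.obj).2 P.property)

instance (T : EhresmannTopology G) : (sheafFunctor.{u, v, w} T).Faithful := by
  unfold sheafFunctor
  infer_instance

instance (T : EhresmannTopology G) : (sheafFunctor.{u, v, w} T).Full := by
  unfold sheafFunctor
  infer_instance

instance (T : EhresmannTopology G) : (sheafFunctor.{u, v, w} T).EssSurj where
  mem_essImage F := by
    let e := presheafFunctorOGPresheafIso F.obj
    -- The sheaf condition is transported along the isomorphism with `F` before being translated to
    -- the ordered groupoid.
    have hF := (isSheaf_iff T _).1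
      (Presieve.isSheaf_iso _ e.symm ((isSheaf_iff_isSheaf_of_type _ _).1 F.property))
    exact ⟨⟨ogPresheaf F.obj, hF⟩, ⟨ObjectProperty.isoMk _ e⟩⟩

instance (T : EhresmannTopology G) : (sheafFunctor.{u, v, w} T).IsEquivalence where

end Category

/-! ### Functoriality -/

section Functoriality

variable {G : Type u₁} [Groupoid.{v₁} G] [OrderedGroupoid G]
  {G' : Type u₂} [Groupoid.{v₂} G'] [OrderedGroupoid G']

/-- The functor between the associated categories given by a double functor. -/
noncomputable def functor (M : OrderedFunctor G G') :
    AssociatedCategory G ⥤ AssociatedCategory G' where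
  obj A := of (M.obj A.as)
  map f := (⟨M.obj f.mid, M.map f.hom, M.obj_le_obj f.mid_le⟩ : Hom (of _) (of _))
  map_id A := hom_ext (congrArg arr (M.map_id A.as))
  map_comp {A B C} f g := by
    -- Since `M` preserves the order, `M.map k` is a restriction of `M.map g.hom` and may be used to
    -- compute the composite.
    obtain ⟨m, k, hk⟩ := exists_restrict g.hom f.mid_le
    rw [comp_eq f g k hk, comp_eq _ _ (M.map k) (M.map_le_map hk)]
    exact hom_ext (congrArg arr (M.map_comp f.hom k))

theorem functor_map_ofLE (M : OrderedFunctor G G') {A B : G} (h : A ≤ᵥ B) :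
    (functor M).map (ofLE h) = ofLE (M.obj_le_obj h) :=
  hom_ext (congrArg arr (M.map_id A))

/-! ### Translation of the conditions on `M` to the associated sites. -/

variable {T : EhresmannTopology G} {T' : EhresmannTopology G'} {M : OrderedFunctor G G'}

theorem coverPreserving (h : CoveringPreserving T T' M) :
    CoverPreserving (topology T) (topology T') (functor M) where
  cover_preserve {A S} hS := by
    refine mem_topology_of_le (A := M.obj A.as) (h A.as (vertical S) hS) fun V hV => ?_
    obtain ⟨B, hB, hVB⟩ := hV
    refine ⟨of B, ofLE hB.1, ofLE hVB, hB.2, ?_⟩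
    rw [functor_map_ofLE]
    exact (ofLE_comp hVB _).symm

/-- Here the image sieve covers in the source site, which is more than `isLocallyFull` records;
`mem_of_functorPushforward_mem` relies on this stronger form. The same holds for `equalizer_mem`. -/
theorem imageSieve_mem (h : LocallyFull T M) {A B : AssociatedCategory G}
    (g : (functor M).obj A ⟶ (functor M).obj B) : (functor M).imageSieve g ∈ topology T A := by
  obtain ⟨S, hS, hS'⟩ := h A.as B.as g.mid g.hom g.mid_le
  refine mem_topology_of_le (A := A.as) hS fun C hC => ?_
  obtain ⟨D, f, hD, hf⟩ := hS' C hC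
  refine ⟨(⟨D, f, hD⟩ : Hom (of C) B), ?_⟩
  rw [functor_map_ofLE]
  exact (ofLE_comp_eq _ g (M.map f) hf).symm

theorem equalizer_mem (h : LocallyFaithful T M) {A B : AssociatedCategory G} (f g : A ⟶ B)
    (e : (functor M).map f = (functor M).map g) : Sieve.equalizer f g ∈ topology T A := by
  have e' : arr (M.map f.hom) = arr (M.map g.hom) :=
    congrArg (fun k : Hom ((functor M).obj A) ((functor M).obj B) => arr k.hom) e
  obtain ⟨S, hS, hS'⟩ := h A.as B.as _ _ f.hom g.hom f.mid_le g.mid_le e'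
  refine mem_topology_of_le (A := A.as) hS fun C hC => ?_
  obtain ⟨D, k, hkf, hkg⟩ := hS' C hC
  exact (ofLE_comp_eq _ f k hkf).trans (ofLE_comp_eq _ g k hkg).symm

theorem isCoverDense (h : LocallySurjective T' M) :
    (functor M).IsCoverDense (topology T') where
  is_cover U := by
    obtain ⟨S, hS, hS'⟩ := h U.as
    refine mem_topology_of_le (A := U.as) hS fun B hB => ?_
    obtain ⟨C, hC, hBC, A, ⟨f⟩⟩ := hS' B hB
    -- The arrow `f` goes from `M A` to `C`; its inverse makes the inclusion `B ≤ C ≤ U` factor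
    -- through the image object `M A`.
    refine ⟨⟨of A, ofLE hBC ≫ ofHom (Groupoid.inv f), ofHom f ≫ ofLE (S.le hC), ?_⟩⟩
    have e : ofHom (Groupoid.inv f) ≫ ofHom f ≫ ofLE (S.le hC) = ofLE (S.le hC) := by
      rw [← Category.assoc, ofHom_inv_comp, Category.id_comp]
    exact (Category.assoc _ _ _).trans
      ((congrArg (ofLE hBC ≫ ·) e).trans (ofLE_comp hBC (S.le hC)))

theorem functorPullback_mem (h : CoContinuous T T' M) {A : AssociatedCategory G}
    {S : Sieve ((functor M).obj A)} (hS : S ∈ topology T' ((functor M).obj A)) :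
    S.functorPullback (functor M) ∈ topology T A := by
  refine mem_topology_of_le (A := A.as) (h A.as (vertical S) hS) fun B hB => ?_
  obtain ⟨hBA, C, hC, hBC⟩ := hB
  have := (vertical (A := M.obj A.as) S).down hBC hC
  change S _
  rw [functor_map_ofLE]
  exact this.2

theorem isLocallyFull (h : CoveringPreserving T T' M) (h' : LocallyFull T M) :
    (functor M).IsLocallyFull (topology T') where
  functorPushforward_imageSieve_mem f := (coverPreserving h).cover_preserve (imageSieve_mem h' f)

theorem isLocallyFaithful (h : CoveringPreserving T T' M) (h' : LocallyFaithful T M) :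
    (functor M).IsLocallyFaithful (topology T') where
  functorPushforward_equalizer_mem f g e :=
    (coverPreserving h).cover_preserve (equalizer_mem h' f g e)

/-- By co-continuity, the morphisms `f` whose image factors as `g ≫ M s` with `s` in `S` form a
cover. Local fullness lifts `g` to some `l`, and local faithfulness turns the resulting equality of
images into an equality upstairs; each step costs one refinement of the cover. -/
theorem mem_of_functorPushforward_mem (hfull : LocallyFull T M) (hfaithful : LocallyFaithful T M)
    (h : CoContinuous T T' M) {A : AssociatedCategory G} {S : Sieve A}
    (hS : S.functorPushforward (functor M) ∈ topology T' ((functor M).obj A)) :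
    S ∈ topology T A := by
  refine (topology T).transitive (functorPullback_mem h hS) _ ?_
  rintro B f ⟨C, s, g, hs, hg⟩
  refine (topology T).transitive (imageSieve_mem hfull g) _ ?_
  rintro X j ⟨l, hl⟩
  -- The morphisms `j ≫ f` and `l ≫ s` agree only after applying `M`; on the cover equalizing them,
  -- `j ≫ f` factors through `s` and hence lies in `S`.
  have e : (functor M).map (j ≫ f) = (functor M).map (l ≫ s) := by
    rw [Functor.map_comp, Functor.map_comp, hl, hg, Category.assoc]
  refine (topology T).superset_covering ?_ (equalizer_mem hfaithful _ _ e)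
  intro Y k (hk : k ≫ j ≫ f = k ≫ l ≫ s)
  change S ((k ≫ j) ≫ f)
  rw [Category.assoc, hk, ← Category.assoc]
  exact S.downward_closed hs _

theorem isDenseSubsite (h : CoveringPreserving T T' M) (hfull : LocallyFull T M)
    (hfaithful : LocallyFaithful T M) (hsurj : LocallySurjective T' M)
    (hcont : CoContinuous T T' M) : (functor M).IsDenseSubsite (topology T) (topology T') where
  isCoverDense' := isCoverDense hsurj
  isLocallyFull' := isLocallyFull h hfull
  isLocallyFaithful' := isLocallyFaithful h hfaithful
  functorPushforward_mem_iff :=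
    ⟨mem_of_functorPushforward_mem hfull hfaithful hcont, (coverPreserving h).cover_preserve⟩

/-- Restriction along `M` corresponds to restriction along the functor of associated categories. -/
noncomputable def sheafRestrictionIso (hM : IsSiteMorphism T T' M)
    [(functor M).IsContinuous (topology T) (topology T')] :
    sheafRestriction.{w, u₁, v₁, u₂, v₂} hM ⋙ sheafFunctor T ≅
      sheafFunctor T' ⋙ (functor M).sheafPushforwardContinuous (Type w) (topology T)
        (topology T') :=
  NatIso.ofComponents (fun P => ObjectProperty.isoMk _ (Iso.refl _)) (by
    intro P Q α
    ext A x
    rfl)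

end Functoriality

end AssociatedCategory

end EhresmannSites

open AssociatedCategory

theorem mainTheorem8 {G G' : Type u} [Groupoid.{u} G] [OrderedGroupoid G]
    [Groupoid.{u} G'] [OrderedGroupoid G']
    (T : EhresmannTopology G) (T' : EhresmannTopology G') (M : OrderedFunctor G G')
    (hM : IsSiteMorphism T T' M)
    (hfull : LocallyFull T M) (hfaithful : LocallyFaithful T M)
    (hsurj : LocallySurjective T' M) :
    ((sheafRestriction.{u, u, u, u, u} hM).Full ∧ (sheafRestriction.{u, u, u, u, u} hM).Faithful) ∧
      (CoContinuous T T' M → (sheafRestriction.{u, u, u, u, u} hM).IsEquivalence) := by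

  have := isCoverDense hsurj
  have := isLocallyFull hM.coveringPreserving hfull
  have := isLocallyFaithful hM.coveringPreserving hfaithful
  -- Continuity is what makes restriction along `functor M` a functor between the sheaf categories
  -- of the associated sites.
  have := Functor.IsCoverDense.isContinuous _ _ (functor M) (coverPreserving hM.coveringPreserving)
  let e := sheafRestrictionIso.{u, u, u, u, u} hM
  have hff : (sheafRestriction.{u, u, u, u, u} hM).Full ∧
      (sheafRestriction.{u, u, u, u, u} hM).Faithful :=
    -- The other side of `e` is an equivalence followed by a fully faithful restriction functor.
    -- Fullness descends to the first factor because `sheafFunctor T` is faithful.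
    ⟨Functor.Full.of_comp_faithful_iso e, Functor.Faithful.of_comp_iso e⟩
  refine ⟨hff, fun hcont => ?_⟩
  have := isDenseSubsite hM.coveringPreserving hfull hfaithful hsurj hcont
  -- For a dense subsite the restriction functor on associated sites is an equivalence, hence so is
  -- the composite with `sheafFunctor T`, and that factor can be cancelled.
  have := Functor.isEquivalence_of_iso e.symm
  exact Functor.isEquivalence_of_comp_right _ (sheafFunctor T)
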